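/- Notation. For a positive integer $d$ let $\mathcal L_d=\frac1d\mathbb Z\times\frac1d\mathbb Z\subset\mathbb R^2$. A rational polygon is a (not necessarily convex) compact region $P\subset\mathbb R^2$, equal to the closure of its interior, whose boundary is a simple closed polygonal line with rational vertices. The Ehrhart function of a bounded set $P\subset\mathbb R^2$ is $\mathrm{ehr}_P(t)=|tP\cap\mathbb Z^2|$ for integers $t\ge 0$; two rational polygons are Ehrhart equivalent if their Ehrhart functions are equal. A $G$-map is a map $x\mapsto Ux+v$ of $\mathbb R^2$ with $U\in GL_2(\mathbb Z)$ and $v\in\mathbb Z^2$. A rational open simplex is a rational point, an open segment with rational endpoints, or an open nondegenerate triangle with rational vertices. Sets $P,Q\subset\mathbb R^2$ are rationally finitely discretely equidecomposable if there are finitely many rational open simplices $T_1,\dots,T_r$ and $G$-maps $g_1,\dots,g_r$ with $P=\bigsqcup_{i=1}^rT_i$ and $Q=\bigsqcup_{i=1}^rg_i(T_i)$ (disjoint unions). A nondegenerate triangle $T$ is $d$-minimal if $T\cap\mathcal L_d$ consists precisely of the vertices of $T$. For $p=(w/d,x/d)$ and $q=(y/d,z/d)$ in $\mathcal L_d$,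 the weight of the oriented edge $p\to q$ is $\det\begin{pmatrix}w&y\\x&z\end{pmatrix}\bmod d$; the weight $W_d(T)$ of a $d$-minimal triangle $T$ is the multiset of the weights of its three edges, oriented counterclockwise around $T$. Theorem. (a) It is not true that any two Ehrhart equivalent rational polygons are rationally finitely discretely equidecomposable. (b) More precisely, let $$T_{(1,2)}=\mathrm{Conv}\left((\tfrac15,0),(0,\tfrac15),(\tfrac15,\tfrac15)\right),\qquad T_{(1,4)}=\mathrm{Conv}\left((\tfrac25,0),(\tfrac15,\tfrac15),(\tfrac25,\tfrac15)\right).$$ These are rational polygons and $5$-minimal triangles. They are Ehrhart equivalent; both have the Ehrhart quasi-polynomial $$\mathrm{ehr}_{T_{(1,2)}}(t)=\mathrm{ehr}_{T_{(1,4)}}(t)=\begin{cases}\frac{t^2}{50}+\frac{3t}{50}-\frac{2}{25}& t\equiv1 \pmod 5\\ \frac{t^2}{50}+\frac{t}{50}-\frac{3}{25}& t\equiv2 \pmod 5\\ \frac{t^2}{50}-\frac{t}{50}-\frac{3}{25}& t\equiv3 \pmod 5\\ \frac{t^2}{50}-\frac{3t}{50}-\frac{2}{25}& t\equiv4 \pmod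 5\\ \frac{t^2}{50}+\frac{3t}{10}+1& t\equiv0 \pmod 5\end{cases}$$ for all integers $t\ge0$. Their weights are $W_5(T_{(1,2)})=\{1,1,-1\}$ and $W_5(T_{(1,4)})=\{2,-2,1\}$ as multisets in $\mathbb Z/5\mathbb Z$, and these differ. The triangles $T_{(1,2)}$ and $T_{(1,4)}$ are not rationally finitely discretely equidecomposable. -/

import Mathlib

noncomputable section

namespace DiscreteEqui

/-- The plane `ℝ²`. -/
abbrev Plane : Type := Fin 2 → ℝ

/-- The lattice `L_d = (1/d)ℤ × (1/d)ℤ` inside the plane. -/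
def lattice (d : ℕ) : Set Plane := {x | ∃ m : Fin 2 → ℤ, ∀ i, x i = (m i : ℝ) / (d : ℝ)}

/-- A point with rational coordinates. -/
def IsRationalPoint (x : Plane) : Prop := ∃ q : Fin 2 → ℚ, ∀ i, x i = (q i : ℝ)

/-! ### Polygons and Ehrhart functions -/

/-- A closed polygonal line without self-intersections: the vertices are distinct, and two
different edges meet at most in common endpoints. -/
def IsSimplePolygon {n : ℕ} [NeZero n] (p : Polygon Plane n) : Prop :=
  3 ≤ n ∧ Function.Injective p.vertices ∧
    ∀ i j : Fin n, i ≠ j → p.edgeSet ℝ i ∩ p.edgeSet ℝ j ⊆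
      {p.vertices i, p.vertices (i + 1)} ∩ {p.vertices j, p.vertices (j + 1)}

/-- A (not necessarily convex) rational polygon: the compact region, equal to the closure of its
interior, that is bounded by a simple closed polygonal line with rational vertices. -/
def IsRationalPolygon (P : Set Plane) : Prop :=
  IsCompact P ∧ closure (interior P) = P ∧
    ∃ (n : ℕ) (_ : NeZero n) (p : Polygon Plane n),
      IsSimplePolygon p ∧ (∀ i, IsRationalPoint (p.vertices i)) ∧ frontier P = p.boundary ℝ

/-- The Ehrhart function `t ↦ |tP ∩ ℤ²|` of a bounded set `P`. -/
def ehr (P : Set Plane) (t : ℕ) : ℕ :=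
  (((fun x : Plane => (t : ℝ) • x) '' P) ∩ lattice 1).ncard

/-- Two sets are Ehrhart equivalent if they have the same Ehrhart function. -/
def EhrhartEquivalent (P Q : Set Plane) : Prop := ∀ t : ℕ, ehr P t = ehr Q t

/-- `f` is the quasi-polynomial of period `d` whose constituent on the residue class of `j` modulo
`d` is `q j`; all constituents have the same degree. -/
def IsQuasiPolynomialWith (d : ℕ) (q : Fin d → Polynomial ℚ) (f : ℕ → ℕ) : Prop :=
  0 < d ∧ (∀ i j, (q i).natDegree = (q j).natDegree) ∧
    ∀ (j : Fin d) (t : ℕ), t % d = (j : ℕ) → (f t : ℚ) = (q j).eval (t : ℚ)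

/-! ### Rational finite discrete equidecomposability -/

/-- The transformation `x ↦ Ux + v` of the plane, for `U ∈ GL₂(ℤ)` and `v ∈ ℤ²`. -/
def gMap (U : Matrix.GeneralLinearGroup (Fin 2) ℤ) (v : Fin 2 → ℤ) (x : Plane) : Plane :=
  Matrix.mulVec ((U : Matrix (Fin 2) (Fin 2) ℤ).map (Int.cast : ℤ → ℝ)) x + fun i => (v i : ℝ)

/-- An affine unimodular map (a `G`-map, `G = GL₂(ℤ) ⋉ ℤ²`). -/
def IsGMap (g : Plane → Plane) : Prop :=
  ∃ (U : Matrix.GeneralLinearGroup (Fin 2) ℤ) (v : Fin 2 → ℤ), g = gMap U v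

/-- The open simplex spanned by `v 0, …, v k`: all convex combinations with strictly positive
coefficients. For `k = 0` it is the one-point set `{v 0}`. -/
def openSimplex {k : ℕ} (v : Fin (k + 1) → Plane) : Set Plane :=
  {x | ∃ w : Fin (k + 1) → ℝ, (∀ i, 0 < w i) ∧ ∑ i, w i = 1 ∧ x = ∑ i, w i • v i}

/-- A rational open simplex: an open simplex (a point, an open segment or an open triangle) with
affinely independent rational vertices. -/
def IsRationalOpenSimplex (S : Set Plane) : Prop :=
  ∃ (k : ℕ) (v : Fin (k + 1) → Plane),
    AffineIndependent ℝ v ∧ (∀ i, IsRationalPoint (v i)) ∧ S = openSimplex v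

/-- Rational finite discrete equidecomposability of `P` and `Q`: `P` is a finite disjoint union of
rational open simplices `T i`, and `Q` is the disjoint union of the images of the `T i` under
suitable `G`-maps `g i`. -/
def RationallyEquidecomposable (P Q : Set Plane) : Prop :=
  ∃ (r : ℕ) (T : Fin r → Set Plane) (g : Fin r → Plane → Plane),
    (∀ i, IsRationalOpenSimplex (T i)) ∧ (∀ i, IsGMap (g i)) ∧
    (∀ i j, i ≠ j → Disjoint (T i) (T j)) ∧ P = ⋃ i, T i ∧
    (∀ i j, i ≠ j → Disjoint (g i '' T i) (g j '' T j)) ∧ Q = ⋃ i, g i '' T i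

/-! ### Minimal triangles and their weights -/

/-- The closed triangle `Conv (v 0, v 1, v 2)`. -/
def triangle (v : Fin 3 → Plane) : Set Plane := convexHull ℝ (Set.range v)

/-- The (nondegenerate) triangle with vertices `v 0, v 1, v 2` is `d`-minimal: it meets `L_d`
precisely in its vertices. -/
def IsMinimalTriangle (d : ℕ) (v : Fin 3 → Plane) : Prop :=
  0 < d ∧ AffineIndependent ℝ v ∧ triangle v ∩ lattice d = Set.range v

/-- The integer numerators `(w, x)` of a point `(w/d, x/d)` of `L_d`. -/
def numer (d : ℕ) (p : Plane) : Fin 2 → ℤ := fun i => ⌊(d : ℝ) * p i⌋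

/-- The weight of the oriented edge `p → q` with endpoints `p = (w/d, x/d)` and `q = (y/d, z/d)`
in `L_d`: the determinant of the matrix with columns `(w, x)` and `(y, z)`, modulo `d`. -/
def edgeWeight (d : ℕ) (p q : Plane) : ZMod d :=
  ((Matrix.det !![numer d p 0, numer d q 0; numer d p 1, numer d q 1] : ℤ) : ZMod d)

/-- The vertices `p, q, r` are in counterclockwise order. -/
def IsCounterclockwise (p q r : Plane) : Prop :=
  0 < (q 0 - p 0) * (r 1 - p 1) - (q 1 - p 1) * (r 0 - p 0)

open Classical in
/-- The weight of a `d`-minimal triangle: the multiset of the weights of its three edges, oriented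
as the triangle's counterclockwise boundary. -/
def triangleWeight (d : ℕ) (v : Fin 3 → Plane) : Multiset (ZMod d) :=
  if IsCounterclockwise (v 0) (v 1) (v 2) then
    {edgeWeight d (v 0) (v 1), edgeWeight d (v 1) (v 2), edgeWeight d (v 2) (v 0)}
  else
    {edgeWeight d (v 1) (v 0), edgeWeight d (v 2) (v 1), edgeWeight d (v 0) (v 2)}

/-! ### The two triangles -/

/-- The vertices `(1/5, 0)`, `(0, 1/5)`, `(1/5, 1/5)` of `T_(1,2)`. -/
def v12 : Fin 3 → Plane := ![![1 / 5, 0], ![0, 1 / 5], ![1 / 5, 1 / 5]]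

/-- The vertices `(2/5, 0)`, `(1/5, 1/5)`, `(2/5, 1/5)` of `T_(1,4)`. -/
def v14 : Fin 3 → Plane := ![![2 / 5, 0], ![1 / 5, 1 / 5], ![2 / 5, 1 / 5]]

open Polynomial in
/-- The constituents, for `t ≡ 0, 1, 2, 3, 4` modulo `5`, of the Ehrhart quasi-polynomial shared by
the two triangles. -/
def sharedConstituents : Fin 5 → ℚ[X] :=
  ![C (1 / 50) * X ^ 2 + C (3 / 10) * X + C 1,
    C (1 / 50) * X ^ 2 + C (3 / 50) * X - C (2 / 25),
    C (1 / 50) * X ^ 2 + C (1 / 50) * X - C (3 / 25),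
    C (1 / 50) * X ^ 2 - C (1 / 50) * X - C (3 / 25),
    C (1 / 50) * X ^ 2 - C (3 / 50) * X - C (2 / 25)]

end DiscreteEqui

end

/-!
The Ehrhart functions of the two triangles are counted directly: for both, the lattice points of the
`t`-th dilate form a triangular array of the same size (`ehr_triangle`).

The reason why the triangles are not equidecomposable is that the weights of the *boundary edges*
of a polygon, up to sign, survive equidecomposition. For a set `S`, a point `x` and a direction `u`,
compare the indicator function of `S` along the beginning of the ray from `x` in direction `u` with
its one-sided limits from the two sides of the ray: twice the former minus the sum of the latter
(`jump`) is additive under disjoint unions, and it is `1` or `0` for a closed polygon according as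
the ray starts along the boundary or not. Sum this quantity over all `x` in `L_5` and all primitive
integral `u` for which `det(5x, u) ≡ ±1` modulo `5` (`flagInvariant`). This index set is stable
under `G`-maps, as these change `det(5x, u)` by a sign and a multiple of `5`, so the sum is an
invariant of equidecomposition (`RationallyEquidecomposable.flagInvariant_eq`). It counts the edges
of weight `±1` of a `5`-minimal triangle, each from both of its endpoints: it is `6` for `T_(1,2)`
and `2` for `T_(1,4)`.

For the pieces of a decomposition the argument needs that the germs in question lie either inside
the piece or outside, that they depend only on the side of the ray, and that only finitely many
flags contribute. All three hold for a set described by the signs of finitely many nonconstant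
affine functions (`IsSignCell`), since on the arc `x + εu + ε²w` such a function is a quadratic
polynomial in `ε`, whose sign for small `ε` is that of its first nonzero coefficient. Open simplices
are such sets, by barycentric coordinates (`isSignCell_openSimplex`).
-/

noncomputable section

namespace DiscreteEqui

open Filter Topology

/-! ### Germs of sets along parabolic arcs -/

/-- The germ at `x` of the arc `ε ↦ x + εu + ε²w`, for `ε` decreasing to `0`, lies in `S`. For
`w = 0` this is the germ of the ray from `x` in direction `u`, and for `w ≠ 0` a germ that leaves
this ray immediately on the side of `w`. -/
def GermMem (S : Set Plane) (x u w : Plane) : Prop :=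
  ∀ᶠ ε in 𝓝[>] (0 : ℝ), x + ε • u + ε ^ 2 • w ∈ S

open Classical in
/-- The indicator function of `GermMem`. -/
def germInd (S : Set Plane) (x u w : Plane) : ℤ := if GermMem S x u w then 1 else 0

/-- The sign of `a + bε + cε²` for small positive `ε`. -/
def lexSign (a b c : ℝ) : SignType :=
  if a ≠ 0 then SignType.sign a else if b ≠ 0 then SignType.sign b else SignType.sign c

lemma eventually_sign_eq {f : ℝ → ℝ} (hf : Continuous f) (h : f 0 ≠ 0) :
    ∀ᶠ ε in 𝓝[>] (0 : ℝ), SignType.sign (f ε) = SignType.sign (f 0) := by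
  have ht : Tendsto f (𝓝[>] 0) (𝓝 (f 0)) := hf.continuousAt.tendsto.mono_left nhdsWithin_le_nhds
  rcases lt_or_gt_of_ne h with h | h
  · filter_upwards [ht.eventually (gt_mem_nhds h)] with ε hε
    rw [sign_neg hε, sign_neg h]
  · filter_upwards [ht.eventually (lt_mem_nhds h)] with ε hε
    rw [sign_pos hε, sign_pos h]

lemma eventually_sign_quadratic (a b c : ℝ) :
    ∀ᶠ ε in 𝓝[>] (0 : ℝ), SignType.sign (a + ε * b + ε ^ 2 * c) = lexSign a b c := by
  unfold lexSign
  split_ifs with ha hb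
  · have h := eventually_sign_eq (f := fun ε => a + ε * (b + ε * c)) (by fun_prop)
      (by simpa using ha)
    filter_upwards [h] with ε hε
    have : a + ε * b + ε ^ 2 * c = a + ε * (b + ε * c) := by ring
    rw [this, hε]
    simp
  · have h := eventually_sign_eq (f := fun ε => b + ε * c) (by fun_prop) (by simpa using hb)
    filter_upwards [h, self_mem_nhdsWithin] with ε hε h0
    simp only [ne_eq, not_not] at ha
    have : a + ε * b + ε ^ 2 * c = ε * (b + ε * c) := by rw [ha]; ring
    rw [this, sign_mul, sign_pos h0, one_mul, hε]
    simp
  · filter_upwards [self_mem_nhdsWithin] with ε h0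
    simp only [ne_eq, not_not] at ha hb
    have : a + ε * b + ε ^ 2 * c = ε ^ 2 * c := by rw [ha, hb]; ring
    rw [this, sign_mul, sign_pos (pow_pos (Set.mem_Ioi.1 h0) 2), one_mul]

lemma affine_apply_arc (l : Plane →ᵃ[ℝ] ℝ) (x u w : Plane) (ε : ℝ) :
    l (x + ε • u + ε ^ 2 • w) = l x + ε * l.linear u + ε ^ 2 * l.linear w := by
  have : x + ε • u + ε ^ 2 • w = (ε • u + ε ^ 2 • w) +ᵥ x := by
    simp only [vadd_eq_add]; abel
  rw [this, l.map_vadd]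
  simp only [map_add, map_smul, smul_eq_mul, vadd_eq_add]
  ring

lemma eventually_sign_affine (l : Plane →ᵃ[ℝ] ℝ) (x u w : Plane) :
    ∀ᶠ ε in 𝓝[>] (0 : ℝ), SignType.sign (l (x + ε • u + ε ^ 2 • w)) =
      lexSign (l x) (l.linear u) (l.linear w) := by
  simp only [affine_apply_arc]
  exact eventually_sign_quadratic _ _ _

/-- A set cut out by prescribing the signs of finitely many nonconstant affine functions. -/
def IsSignCell (S : Set Plane) : Prop :=
  ∃ (ι : Type) (_ : Finite ι) (l : ι → Plane →ᵃ[ℝ] ℝ) (s : ι → SignType),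
    (∀ i, (l i).linear ≠ 0) ∧ S = {y | ∀ i, SignType.sign (l i y) = s i}

lemma germMem_cell_iff {ι : Type} [Finite ι] (l : ι → Plane →ᵃ[ℝ] ℝ) (s : ι → SignType)
    (x u w : Plane) : GermMem {y | ∀ i, SignType.sign (l i y) = s i} x u w ↔
      ∀ i, lexSign (l i x) ((l i).linear u) ((l i).linear w) = s i := by
  have h := eventually_all.2 fun i => eventually_sign_affine (l i) x u w
  unfold GermMem
  rw [eventually_congr (q := fun _ => ∀ i, lexSign (l i x) ((l i).linear u) ((l i).linear w) = s i)]
  · exact eventually_const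
  · filter_upwards [h] with ε hε
    simp only [hε]

/-- An arc germ lies either in a sign cell or in its complement. -/
lemma IsSignCell.eventually_notMem {S : Set Plane} (hS : IsSignCell S) {x u w : Plane}
    (h : ¬ GermMem S x u w) : ∀ᶠ ε in 𝓝[>] (0 : ℝ), x + ε • u + ε ^ 2 • w ∉ S := by
  obtain ⟨ι, _, l, s, -, rfl⟩ := hS
  rw [germMem_cell_iff] at h
  filter_upwards [eventually_all.2 fun i => eventually_sign_affine (l i) x u w] with ε hε
  simpa only [Set.mem_ofPred_eq, hε] using h

/-- Germs of arcs are additive under finite disjoint unions of sign cells; disjointness alone would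
not suffice, as an arc could enter and leave the pieces infinitely often. -/
lemma germInd_iUnion {r : ℕ} (T : Fin r → Set Plane) (hT : ∀ i, IsSignCell (T i))
    (hd : ∀ i j, i ≠ j → Disjoint (T i) (T j)) (x u w : Plane) :
    germInd (⋃ i, T i) x u w = ∑ i, germInd (T i) x u w := by
  by_cases h : ∃ i, GermMem (T i) x u w
  · obtain ⟨i, hi⟩ := h
    rw [Finset.sum_eq_single i]
    · have : GermMem (⋃ i, T i) x u w := hi.mono fun ε hε => Set.mem_iUnion_of_mem i hε
      simp [germInd, hi, this]
    · intro j _ hji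
      have : ¬ GermMem (T j) x u w := fun hj => by
        obtain ⟨ε, h1, h2⟩ := (hi.and hj).exists
        exact Set.disjoint_left.1 (hd j i hji) h2 h1
      simp [germInd, this]
    · simp
  · push Not at h
    have h' := eventually_all.2 fun i => (hT i).eventually_notMem (h i)
    have : ¬ GermMem (⋃ i, T i) x u w := fun hu => by
      obtain ⟨ε, h1, h2⟩ := (hu.and h').exists
      obtain ⟨i, hi⟩ := Set.mem_iUnion.1 h1
      exact h2 i hi
    simp [germInd, h, this]

/-- The determinant of two vectors of the plane. -/
def det2 (u w : Plane) : ℝ := u 0 * w 1 - u 1 * w 0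

lemma linear_apply_eq (f : Plane →ₗ[ℝ] ℝ) (y : Plane) :
    f y = y 0 * f (Pi.single 0 1) + y 1 * f (Pi.single 1 1) := by
  have : y = y 0 • Pi.single 0 1 + y 1 • Pi.single 1 1 := by
    ext i; fin_cases i <;> simp
  conv_lhs => rw [this]
  simp only [map_add, map_smul, smul_eq_mul]

/-- The germ of a sign cell along an arc depends on the second-order term only through the side of
the tangent on which it lies: a linear form vanishing on `u` is a multiple of `det2 u`. -/
lemma IsSignCell.germMem_congr {S : Set Plane} (hS : IsSignCell S) {x u w w' : Plane}
    (hu : u ≠ 0) (hw : SignType.sign (det2 u w) = SignType.sign (det2 u w')) :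
    GermMem S x u w ↔ GermMem S x u w' := by
  obtain ⟨ι, _, l, s, -, rfl⟩ := hS
  rw [germMem_cell_iff, germMem_cell_iff]
  have key : ∀ i, lexSign (l i x) ((l i).linear u) ((l i).linear w) =
      lexSign (l i x) ((l i).linear u) ((l i).linear w') := by
    intro i
    unfold lexSign
    split_ifs with ha hb
    · rfl
    · rfl
    · simp only [ne_eq, not_not] at hb
      set f := (l i).linear
      have hpos : 0 < u 0 ^ 2 + u 1 ^ 2 := by
        by_contra hneg
        apply hu
        ext j
        fin_cases j
        · show u 0 = 0
          nlinarith [sq_nonneg (u 0), sq_nonneg (u 1)]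
        · show u 1 = 0
          nlinarith [sq_nonneg (u 0), sq_nonneg (u 1)]
      have hmul : ∀ y, (u 0 ^ 2 + u 1 ^ 2) * f y =
          (u 0 * f (Pi.single 1 1) - u 1 * f (Pi.single 0 1)) * det2 u y := by
        intro y
        rw [linear_apply_eq f u] at hb
        rw [linear_apply_eq f y, det2]
        linear_combination (y 0 * u 0 + y 1 * u 1) * hb
      have hs : ∀ y, SignType.sign (f y) =
          SignType.sign (u 0 * f (Pi.single 1 1) - u 1 * f (Pi.single 0 1)) *
            SignType.sign (det2 u y) := by
        intro y
        rw [← sign_mul, ← hmul, sign_mul, sign_pos hpos, one_mul]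
      rw [hs w, hs w', hw]
  simp only [key]

/-- Open simplices are sign cells for the barycentric coordinates of any affine basis extending
their vertices. -/
lemma isSignCell_openSimplex {k : ℕ} {v : Fin (k + 1) → Plane} (hv : AffineIndependent ℝ v) :
    IsSignCell (openSimplex v) := by
  classical
  obtain ⟨t, hvt, ht, htop⟩ := exists_subset_affineIndependent_affineSpan_eq_top hv.range
  let b : AffineBasis t ℝ Plane := ⟨((↑) : t → Plane), ht, by simpa using htop⟩
  have hfin : Finite t := finite_of_fin_dim_affineIndependent ℝ ht
  have := Fintype.ofFinite t
  have hnt : Nontrivial t := by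
    by_contra hcon
    rw [not_nontrivial_iff_subsingleton] at hcon
    have h1 : Fintype.card t = Module.finrank ℝ Plane + 1 := b.card_eq_finrank_add_one
    have := Fintype.card_le_one_iff_subsingleton.2 hcon
    rw [Module.finrank_fin_fun] at h1
    omega
  let e : Fin (k + 1) → t := fun i => ⟨v i, hvt ⟨i, rfl⟩⟩
  have he : Function.Injective e := fun i j hij => hv.injective (congrArg Subtype.val hij)
  refine ⟨t, hfin, b.coord, fun j => if j ∈ Set.range e then 1 else 0, fun i => ?_, ?_⟩
  · intro h0
    have hs := (b.coord i).linear_surjective_iff.2 (b.surjective_coord i)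
    rw [h0] at hs
    obtain ⟨y, hy⟩ := hs 1
    simp at hy
  · ext y
    simp only [openSimplex, Set.mem_ofPred_eq]
    constructor
    · rintro ⟨w, hw, hsum, rfl⟩ j
      have hc : b.coord j (∑ i, w i • v i) = ∑ i, w i * (if j = e i then 1 else 0) := by
        rw [← Finset.affineCombination_eq_linear_combination _ _ _ hsum,
          Finset.map_affineCombination _ _ _ hsum,
          Finset.affineCombination_eq_linear_combination _ _ _ hsum]
        refine Finset.sum_congr rfl fun i _ => ?_
        have : b.coord j (b (e i)) = if j = e i then 1 else 0 := b.coord_apply j (e i)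
        rw [← this]
        rfl
      rw [hc]
      split_ifs with hj
      · obtain ⟨i, rfl⟩ := hj
        rw [Finset.sum_eq_single i (fun i' _ hi' => by
          rw [if_neg fun h => hi' (he h).symm, mul_zero]) (by simp), if_pos rfl, mul_one,
          sign_pos (hw i)]
      · rw [Finset.sum_eq_zero, sign_zero]
        intro i _
        rw [if_neg (fun h => hj ⟨i, h.symm⟩), mul_zero]
    · intro h
      have hsum : ∑ i, b.coord (e i) y = 1 ∧ y = ∑ i, b.coord (e i) y • v i := by
        have hz : ∀ j, j ∉ Set.range e → b.coord j y = 0 := fun j hj => by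
          have := h j
          rwa [if_neg hj, sign_eq_zero_iff] at this
        constructor
        · rw [← b.sum_coord_apply_eq_one y]
          exact Fintype.sum_of_injective e he _ _ hz (fun _ => rfl)
        · conv_lhs => rw [← b.linear_combination_coord_eq_self y]
          exact (Fintype.sum_of_injective e he _ _ (fun j hj => by rw [hz j hj, zero_smul])
            (fun _ => rfl)).symm
      refine ⟨fun i => b.coord (e i) y, fun i => ?_, hsum.1, hsum.2⟩
      have := h (e i)
      rwa [if_pos ⟨i, rfl⟩, sign_eq_one_iff] at this

lemma image_openSimplex (g : Plane →ᵃ[ℝ] Plane) {k : ℕ} (v : Fin (k + 1) → Plane) :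
    g '' openSimplex v = openSimplex (g ∘ v) := by
  have h : ∀ w : Fin (k + 1) → ℝ, ∑ i, w i = 1 → g (∑ i, w i • v i) = ∑ i, w i • g (v i) := by
    intro w hw
    rw [← Finset.affineCombination_eq_linear_combination _ _ _ hw,
      Finset.map_affineCombination _ _ _ hw,
      Finset.affineCombination_eq_linear_combination _ _ _ hw]
    rfl
  ext y
  constructor
  · rintro ⟨x, ⟨w, hw, hsum, rfl⟩, rfl⟩
    exact ⟨w, hw, hsum, h w hsum⟩
  · rintro ⟨w, hw, hsum, rfl⟩
    exact ⟨_, ⟨w, hw, hsum, rfl⟩, h w hsum⟩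

lemma isBounded_openSimplex {k : ℕ} (v : Fin (k + 1) → Plane) :
    Bornology.IsBounded (openSimplex v) := by
  refine (isBounded_convexHull.2 (Set.finite_range v).isBounded).subset ?_
  rintro x ⟨w, hw, hsum, rfl⟩
  exact (convex_convexHull ℝ _).sum_mem (fun i _ => (hw i).le) hsum
    fun i _ => subset_convexHull ℝ _ ⟨i, rfl⟩

/-! ### Flags and the flag invariant -/

/-- The point `(m₁/5, m₂/5)` of the lattice `L_5`. -/
def latticePoint (m : ℤ × ℤ) : Plane := ![(m.1 : ℝ) / 5, (m.2 : ℝ) / 5]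

/-- An integral vector, as a vector of the plane. -/
def intVec (u : ℤ × ℤ) : Plane := ![(u.1 : ℝ), (u.2 : ℝ)]

/-- The pair `(m, u)` stands for the ray from the point `m/5` of `L_5` in direction `u`. It is a
flag of weight `±1` if `u` is primitive and `det(m, u) ≡ ±1` modulo `5`. -/
def IsUnitFlag (f : (ℤ × ℤ) × (ℤ × ℤ)) : Prop :=
  IsCoprime f.2.1 f.2.2 ∧ (5 : ℤ) ∣ (f.1.1 * f.2.2 - f.1.2 * f.2.1) ^ 2 - 1

/-- For the ray `(m, u)`, twice the indicator function of `S` along the beginning of the ray, minus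
its one-sided limits from the left and from the right. For a closed polygon this is `1` if the ray
starts along the boundary and `0` otherwise. -/
def jump (S : Set Plane) (f : (ℤ × ℤ) × (ℤ × ℤ)) : ℤ :=
  2 * germInd S (latticePoint f.1) (intVec f.2) 0
    - germInd S (latticePoint f.1) (intVec f.2) (intVec (-f.2.2, f.2.1))
    - germInd S (latticePoint f.1) (intVec f.2) (intVec (f.2.2, -f.2.1))

open Classical in
/-- The restriction of `jump` to the flags of weight `±1`. -/
def flagJump (S : Set Plane) (f : (ℤ × ℤ) × (ℤ × ℤ)) : ℤ := if IsUnitFlag f then jump S f else 0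

/-- The sum of `jump S` over all flags of weight `±1`. -/
def flagInvariant (S : Set Plane) : ℤ := ∑ᶠ f, flagJump S f

lemma flagJump_iUnion {r : ℕ} (T : Fin r → Set Plane) (hT : ∀ i, IsSignCell (T i))
    (hd : ∀ i j, i ≠ j → Disjoint (T i) (T j)) (f : (ℤ × ℤ) × (ℤ × ℤ)) :
    flagJump (⋃ i, T i) f = ∑ i, flagJump (T i) f := by
  unfold flagJump
  split_ifs with h
  · unfold jump
    simp only [germInd_iUnion T hT hd, Finset.sum_sub_distrib, Finset.mul_sum]
  · simp

/-! ### Finiteness of the support -/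

/-- A line through the origin contains at most two primitive vectors. -/
lemma finite_coprime_line {p q : ℝ} (h : p ≠ 0 ∨ q ≠ 0) :
    {u : ℤ × ℤ | IsCoprime u.1 u.2 ∧ u.1 * p + u.2 * q = 0}.Finite := by
  by_cases hne : ∃ u : ℤ × ℤ, IsCoprime u.1 u.2 ∧ u.1 * p + u.2 * q = 0
  · obtain ⟨u, hu, hu0⟩ := hne
    refine (Set.toFinite {u, -u}).subset ?_
    rintro w ⟨hw, hw0⟩
    have hdet : u.1 * w.2 - u.2 * w.1 = 0 := by
      have h1 : ((u.1 * w.2 - u.2 * w.1 : ℤ) : ℝ) * p = 0 := by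
        push_cast; linear_combination (w.2 : ℝ) * hu0 - (u.2 : ℝ) * hw0
      have h2 : ((u.1 * w.2 - u.2 * w.1 : ℤ) : ℝ) * q = 0 := by
        push_cast; linear_combination (u.1 : ℝ) * hw0 - (w.1 : ℝ) * hu0
      rcases h with h | h
      · exact_mod_cast (mul_eq_zero.1 h1).resolve_right h
      · exact_mod_cast (mul_eq_zero.1 h2).resolve_right h
    obtain ⟨a, b, hab⟩ := hu
    obtain ⟨c, d, hcd⟩ := hw
    -- `w = k u` and `u = l w` with integers `k`, `l`, by the Bézout relations
    have e1 : w.1 = (a * w.1 + b * w.2) * u.1 := by linear_combination -w.1 * hab - b * hdet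
    have e2 : w.2 = (a * w.1 + b * w.2) * u.2 := by linear_combination -w.2 * hab + a * hdet
    have hunit : (c * u.1 + d * u.2) * (a * w.1 + b * w.2) = 1 := by
      linear_combination hcd - c * e1 - d * e2
    rcases Int.eq_one_or_neg_one_of_mul_eq_one' hunit with ⟨-, hk⟩ | ⟨-, hk⟩
    · left
      rw [hk] at e1 e2
      exact Prod.ext (by linarith) (by linarith)
    · right
      rw [hk] at e1 e2
      exact Prod.ext (by rw [Prod.fst_neg]; linarith) (by rw [Prod.snd_neg]; linarith)
  · refine Set.finite_empty.subset fun u hu => hne ⟨u, hu⟩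

lemma germMem_mem_closure {S : Set Plane} {x u w : Plane} (h : GermMem S x u w) :
    x ∈ closure S := by
  have ht : Tendsto (fun ε : ℝ => x + ε • u + ε ^ 2 • w) (𝓝[>] 0) (𝓝 x) := by
    have hc : Continuous fun ε : ℝ => x + ε • u + ε ^ 2 • w := by fun_prop
    have := hc.tendsto 0
    simp only [zero_smul, add_zero, ne_eq, OfNat.ofNat_ne_zero, not_false_eq_true, zero_pow] at this
    exact this.mono_left nhdsWithin_le_nhds
  exact mem_closure_of_tendsto ht h

lemma jump_ne_zero_mem_closure {S : Set Plane} {f : (ℤ × ℤ) × (ℤ × ℤ)} (h : jump S f ≠ 0) :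
    latticePoint f.1 ∈ closure S := by
  by_contra hx
  have : ∀ u w, germInd S (latticePoint f.1) u w = 0 := fun u w =>
    if_neg fun hg => hx (germMem_mem_closure hg)
  exact h (by simp only [jump, this]; rfl)

lemma finite_latticePoint_mem {S : Set Plane} (hS : Bornology.IsBounded S) :
    {m : ℤ × ℤ | latticePoint m ∈ S}.Finite := by
  obtain ⟨R, hR⟩ := hS.exists_norm_le
  have hb : ∀ (a : ℤ), |(a : ℝ) / 5| ≤ R → a ∈ Set.Icc (-⌈5 * R⌉) ⌈5 * R⌉ := by
    intro a ha
    have h1 := abs_le.1 ha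
    have h2 := Int.le_ceil (5 * R)
    constructor
    · have : (-⌈5 * R⌉ : ℝ) ≤ a := by linarith
      exact_mod_cast this
    · have : (a : ℝ) ≤ ⌈5 * R⌉ := by linarith
      exact_mod_cast this
  refine ((Set.finite_Icc (-⌈5 * R⌉) ⌈5 * R⌉).prod (Set.finite_Icc (-⌈5 * R⌉) ⌈5 * R⌉)).subset ?_
  intro m hm
  have hn := hR _ hm
  exact ⟨hb _ ((norm_le_pi_norm (latticePoint m) 0).trans hn),
    hb _ ((norm_le_pi_norm (latticePoint m) 1).trans hn)⟩

/-- Only finitely many flags contribute for a bounded sign cell: their base points lie in its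
closure, and their directions are parallel to one of the lines bounding the cell. -/
lemma IsSignCell.finite_support_flagJump {S : Set Plane} (hS : IsSignCell S)
    (hb : Bornology.IsBounded S) : (Function.support (flagJump S)).Finite := by
  obtain ⟨ι, _, l, s, hl, hSeq⟩ := hS
  have hfin : ∀ i, {u : ℤ × ℤ | IsCoprime u.1 u.2 ∧
      u.1 * (l i).linear (Pi.single 0 1) + u.2 * (l i).linear (Pi.single 1 1) = 0}.Finite := by
    refine fun i => finite_coprime_line ?_
    by_contra! hcon
    refine hl i (LinearMap.ext fun y => ?_)
    rw [linear_apply_eq, hcon.1, hcon.2]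
    simp
  refine ((finite_latticePoint_mem hb.closure).prod (Set.finite_iUnion hfin)).subset ?_
  intro f hf
  rw [Function.mem_support] at hf
  have hflag : IsUnitFlag f := by
    by_contra hn
    exact hf (if_neg hn)
  rw [flagJump, if_pos hflag] at hf
  refine ⟨jump_ne_zero_mem_closure hf, ?_⟩
  by_contra hu
  have hu' : ∀ i, (l i).linear (intVec f.2) ≠ 0 := by
    intro i h0
    refine hu (Set.mem_iUnion.2 ⟨i, hflag.1, ?_⟩)
    rw [linear_apply_eq] at h0
    simpa [intVec] using h0
  -- the first-order term decides all signs, so the three germs agree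
  have : ∀ w, germInd S (latticePoint f.1) (intVec f.2) w =
      germInd S (latticePoint f.1) (intVec f.2) 0 := by
    intro w
    unfold germInd
    congr 1
    rw [hSeq, germMem_cell_iff, germMem_cell_iff]
    simp only [lexSign, ne_eq, hu', not_false_eq_true, if_true]
  apply hf
  simp only [jump, this]
  ring

/-! ### Invariance -/

lemma intVec_ne_zero {u : ℤ × ℤ} (hu : IsCoprime u.1 u.2) : intVec u ≠ 0 := by
  intro h
  have h0 := congrFun h 0
  have h1 := congrFun h 1
  simp only [intVec, Matrix.cons_val_zero, Matrix.cons_val_one, Pi.zero_apply,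
    Int.cast_eq_zero] at h0 h1
  rw [h0, h1] at hu
  exact not_isCoprime_zero_zero hu

/-- The action of the affine map with linear part `!![a, b; c, d]` and translation `(p, q)` on
flags; a point of `L_5` is recorded by its numerators, whence the factor `5`. The number `e` is the
determinant, which is its own inverse. -/
def flagEquiv (a b c d e p q : ℤ) (hdet : a * d - b * c = e) (he : e * e = 1) :
    (ℤ × ℤ) × (ℤ × ℤ) ≃ (ℤ × ℤ) × (ℤ × ℤ) where
  toFun f := ((a * f.1.1 + b * f.1.2 + 5 * p, c * f.1.1 + d * f.1.2 + 5 * q),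
    (a * f.2.1 + b * f.2.2, c * f.2.1 + d * f.2.2))
  invFun f := ((e * (d * (f.1.1 - 5 * p) - b * (f.1.2 - 5 * q)),
      e * (a * (f.1.2 - 5 * q) - c * (f.1.1 - 5 * p))),
    (e * (d * f.2.1 - b * f.2.2), e * (a * f.2.2 - c * f.2.1)))
  left_inv f := by
    refine Prod.ext (Prod.ext ?_ ?_) (Prod.ext ?_ ?_) <;> dsimp only
    · linear_combination e * f.1.1 * hdet + f.1.1 * he
    · linear_combination e * f.1.2 * hdet + f.1.2 * he
    · linear_combination e * f.2.1 * hdet + f.2.1 * he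
    · linear_combination e * f.2.2 * hdet + f.2.2 * he
  right_inv f := by
    refine Prod.ext (Prod.ext ?_ ?_) (Prod.ext ?_ ?_) <;> dsimp only
    · linear_combination e * (f.1.1 - 5 * p) * hdet + (f.1.1 - 5 * p) * he
    · linear_combination e * (f.1.2 - 5 * q) * hdet + (f.1.2 - 5 * q) * he
    · linear_combination e * f.2.1 * hdet + f.2.1 * he
    · linear_combination e * f.2.2 * hdet + f.2.2 * he

lemma isUnitFlag_flagEquiv {a b c d e p q : ℤ} (hdet : a * d - b * c = e) (he : e * e = 1)
    (f : (ℤ × ℤ) × (ℤ × ℤ)) :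
    IsUnitFlag (flagEquiv a b c d e p q hdet he f) ↔ IsUnitFlag f := by
  obtain ⟨⟨m, n⟩, ⟨u, w⟩⟩ := f
  simp only [IsUnitFlag, flagEquiv, Equiv.coe_fn_mk]
  refine and_congr ⟨?_, ?_⟩ ?_
  · rintro ⟨s, t, hst⟩
    exact ⟨s * a + t * c, s * b + t * d, by linear_combination hst⟩
  · rintro ⟨s, t, hst⟩
    refine ⟨e * (s * d - t * c), e * (t * a - s * b), ?_⟩
    linear_combination hst + e * (s * u + t * w) * hdet + (s * u + t * w) * he
  · subst hdet
    rw [← dvd_add_left (b := (m * w - n * u) ^ 2 - 1)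
      (dvd_mul_right (5 : ℤ) (2 * (a * d - b * c) * (m * w - n * u) *
          (p * (c * u + d * w) - q * (a * u + b * w)) +
        5 * (p * (c * u + d * w) - q * (a * u + b * w)) ^ 2))]
    refine iff_of_eq (congrArg _ ?_)
    linear_combination (m * w - n * u) ^ 2 * he

/-- Coordinates of the image of a point under a `G`-map. -/
lemma gMap_apply (U : Matrix.GeneralLinearGroup (Fin 2) ℤ) (v : Fin 2 → ℤ) (x : Plane) :
    gMap U v x = ![(U 0 0 : ℝ) * x 0 + (U 0 1 : ℝ) * x 1 + v 0,
      (U 1 0 : ℝ) * x 0 + (U 1 1 : ℝ) * x 1 + v 1] := by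
  ext i
  fin_cases i <;> simp [gMap]

lemma gMap_injective (U : Matrix.GeneralLinearGroup (Fin 2) ℤ) (v : Fin 2 → ℤ) :
    Function.Injective (gMap U v) := by
  intro x y h
  simp only [gMap, add_left_inj] at h
  have h2 := congrArg (Matrix.mulVec (((U⁻¹ : Matrix.GeneralLinearGroup (Fin 2) ℤ) :
    Matrix (Fin 2) (Fin 2) ℤ).map (Int.cast : ℤ → ℝ))) h
  have hm : (((U⁻¹ : Matrix.GeneralLinearGroup (Fin 2) ℤ) :
      Matrix (Fin 2) (Fin 2) ℤ).map (Int.cast : ℤ → ℝ)) *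
      ((U : Matrix (Fin 2) (Fin 2) ℤ).map (Int.cast : ℤ → ℝ)) = 1 := by
    have := Matrix.map_mul (L := ((U⁻¹ : Matrix.GeneralLinearGroup (Fin 2) ℤ) :
      Matrix (Fin 2) (Fin 2) ℤ)) (M := (U : Matrix (Fin 2) (Fin 2) ℤ)) (f := Int.castRingHom ℝ)
    rw [← Units.val_mul, inv_mul_cancel] at this
    simpa using this.symm
  simpa only [Matrix.mulVec_mulVec, hm, Matrix.one_mulVec] using h2

lemma germMem_gMap_image (U : Matrix.GeneralLinearGroup (Fin 2) ℤ) (v : Fin 2 → ℤ)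
    (S : Set Plane) (x u w : Plane) :
    GermMem (gMap U v '' S) (gMap U v x) (gMap U 0 u) (gMap U 0 w) ↔ GermMem S x u w := by
  unfold GermMem
  refine eventually_congr (Eventually.of_forall fun ε => ?_)
  have : gMap U v x + ε • gMap U 0 u + ε ^ 2 • gMap U 0 w =
      gMap U v (x + ε • u + ε ^ 2 • w) := by
    simp only [gMap_apply]
    ext i
    fin_cases i <;> simp <;> ring
  rw [this, (gMap_injective U v).mem_set_image]

/-- A `G`-map carries the left and right side of a ray to the left and right side of the image ray,
in this or in the opposite order. -/
lemma jump_gMap_image {S : Set Plane} (hS : IsSignCell S)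
    (U : Matrix.GeneralLinearGroup (Fin 2) ℤ) (v : Fin 2 → ℤ) {e : ℤ}
    (hdet : U 0 0 * U 1 1 - U 0 1 * U 1 0 = e) (he : e * e = 1) {f : (ℤ × ℤ) × (ℤ × ℤ)}
    (hf : IsUnitFlag f) :
    jump (gMap U v '' S) (flagEquiv _ _ _ _ e (v 0) (v 1) hdet he f) = jump S f := by
  obtain ⟨m, u⟩ := f
  have hu : IsCoprime u.1 u.2 := hf.1
  have hu0 := intVec_ne_zero hu
  have hcop := ((isUnitFlag_flagEquiv (p := v 0) (q := v 1) hdet he (m, u)).2 hf).1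
  simp only [flagEquiv, Equiv.coe_fn_mk] at hcop
  have hpos : ∀ {u : ℤ × ℤ}, IsCoprime u.1 u.2 → 0 < u.1 ^ 2 + u.2 ^ 2 := by
    intro u hu
    by_contra! hle
    have h1 : u.1 = 0 := by nlinarith [sq_nonneg u.1, sq_nonneg u.2]
    have h2 : u.2 = 0 := by nlinarith [sq_nonneg u.1, sq_nonneg u.2]
    rw [h1, h2] at hu
    exact not_isCoprime_zero_zero hu
  have hpt : latticePoint (U 0 0 * m.1 + U 0 1 * m.2 + 5 * v 0,
      U 1 0 * m.1 + U 1 1 * m.2 + 5 * v 1) = gMap U v (latticePoint m) := by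
    rw [gMap_apply]
    ext i
    fin_cases i <;> simp [latticePoint] <;> ring
  have hvec : ∀ w : ℤ × ℤ, intVec (U 0 0 * w.1 + U 0 1 * w.2, U 1 0 * w.1 + U 1 1 * w.2) =
      gMap U 0 (intVec w) := by
    intro w
    rw [gMap_apply]
    ext i
    fin_cases i <;> simp [intVec]
  have hzero : gMap U 0 0 = 0 := by
    rw [gMap_apply]
    ext i
    fin_cases i <;> simp
  -- the inverse image of an integral vector `r` under the linear part
  have hinv : ∀ r : ℤ × ℤ, intVec r =
      gMap U 0 (intVec (e * (U 1 1 * r.1 - U 0 1 * r.2), e * (U 0 0 * r.2 - U 1 0 * r.1))) := by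
    intro r
    rw [← hvec]
    congr 1
    refine Prod.ext ?_ ?_ <;> dsimp only
    · linear_combination -e * r.1 * hdet - r.1 * he
    · linear_combination -e * r.2 * hdet - r.2 * he
  have hside : ∀ r s : ℤ × ℤ,
      SignType.sign (e * ((U 0 0 * u.1 + U 0 1 * u.2) * r.2 - (U 1 0 * u.1 + U 1 1 * u.2) * r.1)) =
        SignType.sign (u.1 * s.2 - u.2 * s.1) →
      germInd (gMap U v '' S) (gMap U v (latticePoint m)) (gMap U 0 (intVec u)) (intVec r) =
        germInd S (latticePoint m) (intVec u) (intVec s) := by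
    intro r s hrs
    unfold germInd
    congr 1
    rw [hinv r, germMem_gMap_image]
    refine propext (hS.germMem_congr hu0 ?_)
    have hcast : ∀ z : ℤ, SignType.sign (z : ℝ) = SignType.sign z := fun z => by
      rcases lt_trichotomy z 0 with h | h | h
      · rw [sign_neg h, sign_neg (by exact_mod_cast h)]
      · simp [h]
      · rw [sign_pos h, sign_pos (by exact_mod_cast h)]
    rw [← hcast, ← hcast] at hrs
    convert hrs using 2
    · simp only [det2, intVec, Matrix.cons_val_zero, Matrix.cons_val_one]
      push_cast
      ring
    · simp only [det2, intVec, Matrix.cons_val_zero, Matrix.cons_val_one]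
      push_cast
      ring
  have hmid : germInd (gMap U v '' S) (gMap U v (latticePoint m)) (gMap U 0 (intVec u)) 0 =
      germInd S (latticePoint m) (intVec u) 0 := by
    unfold germInd
    congr 1
    conv_lhs => rw [← hzero, germMem_gMap_image]
  have h1 := hpos hu
  have h2 := hpos (u := (_, _)) hcop
  simp only [jump, flagEquiv, Equiv.coe_fn_mk, hpt]
  rw [hvec u, hmid]
  rcases Int.eq_one_or_neg_one_of_mul_eq_one he with h | h
  · rw [hside _ (-u.2, u.1), hside _ (u.2, -u.1)]
    · rw [sign_neg (by rw [h]; nlinarith), sign_neg (by nlinarith)]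
    · rw [sign_pos (by rw [h]; nlinarith), sign_pos (by nlinarith)]
  -- a reflection exchanges the two sides of the ray
  · rw [hside _ (u.2, -u.1), hside _ (-u.2, u.1)]
    · ring
    · rw [sign_pos (by rw [h]; nlinarith), sign_pos (by nlinarith)]
    · rw [sign_neg (by rw [h]; nlinarith), sign_neg (by nlinarith)]

lemma exists_equiv_flagJump_gMap_image {S : Set Plane} (hS : IsSignCell S)
    (U : Matrix.GeneralLinearGroup (Fin 2) ℤ) (v : Fin 2 → ℤ) :
    ∃ E : (ℤ × ℤ) × (ℤ × ℤ) ≃ (ℤ × ℤ) × (ℤ × ℤ),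
      ∀ f, flagJump (gMap U v '' S) (E f) = flagJump S f := by
  have he : IsUnit (U 0 0 * U 1 1 - U 0 1 * U 1 0 : ℤ) := by
    rw [← Matrix.det_fin_two]
    exact (Matrix.isUnit_iff_isUnit_det _).1 U.isUnit
  refine ⟨flagEquiv _ _ _ _ _ (v 0) (v 1) rfl (Int.isUnit_mul_self he), fun f => ?_⟩
  unfold flagJump
  by_cases hf : IsUnitFlag f
  · rw [if_pos hf, if_pos ((isUnitFlag_flagEquiv _ _ f).2 hf), jump_gMap_image hS U v _ _ hf]
  · rw [if_neg hf, if_neg (mt (isUnitFlag_flagEquiv _ _ f).1 hf)]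

/-- A `G`-map as an affine map. -/
def gAffine (U : Matrix.GeneralLinearGroup (Fin 2) ℤ) (v : Fin 2 → ℤ) : Plane →ᵃ[ℝ] Plane :=
  (Matrix.mulVecLin ((U : Matrix (Fin 2) (Fin 2) ℤ).map (Int.cast : ℤ → ℝ))).toAffineMap +
    AffineMap.const ℝ Plane fun i => (v i : ℝ)

lemma coe_gAffine (U : Matrix.GeneralLinearGroup (Fin 2) ℤ) (v : Fin 2 → ℤ) :
    ⇑(gAffine U v) = gMap U v := rfl

lemma isSignCell_gMap_image {S : Set Plane} (hS : IsRationalOpenSimplex S)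
    (U : Matrix.GeneralLinearGroup (Fin 2) ℤ) (v : Fin 2 → ℤ) : IsSignCell (gMap U v '' S) := by
  obtain ⟨k, p, hp, -, rfl⟩ := hS
  rw [← coe_gAffine, image_openSimplex]
  refine isSignCell_openSimplex (hp.map' _ ?_)
  rw [coe_gAffine]
  exact gMap_injective U v

theorem RationallyEquidecomposable.flagInvariant_eq {P Q : Set Plane}
    (h : RationallyEquidecomposable P Q) : flagInvariant P = flagInvariant Q := by
  obtain ⟨r, T, g, hT, hg, hdT, rfl, hdg, rfl⟩ := h
  have hcell : ∀ i, IsSignCell (T i) := fun i => by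
    obtain ⟨k, p, hp, -, h⟩ := hT i
    exact h ▸ isSignCell_openSimplex hp
  have hfin : ∀ i, (Function.support (flagJump (T i))).Finite := fun i => by
    obtain ⟨k, p, -, -, h⟩ := hT i
    exact (hcell i).finite_support_flagJump (h ▸ isBounded_openSimplex p)
  have hcell' : ∀ i, IsSignCell (g i '' T i) := fun i => by
    obtain ⟨U, v, hi⟩ := hg i
    exact hi ▸ isSignCell_gMap_image (hT i) U v
  have hE : ∀ i, ∃ E : (ℤ × ℤ) × (ℤ × ℤ) ≃ (ℤ × ℤ) × (ℤ × ℤ),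
      ∀ f, flagJump (g i '' T i) (E f) = flagJump (T i) f := fun i => by
    obtain ⟨U, v, hi⟩ := hg i
    exact hi ▸ exists_equiv_flagJump_gMap_image (hcell i) U v
  have hfin' : ∀ i, (Function.support (flagJump (g i '' T i))).Finite := fun i => by
    obtain ⟨E, hE⟩ := hE i
    refine ((hfin i).image E).subset fun f hf => ⟨E.symm f, ?_, E.apply_symm_apply f⟩
    rw [Function.mem_support, ← hE, E.apply_symm_apply]
    exact hf
  unfold flagInvariant
  simp only [flagJump_iUnion T hcell hdT, flagJump_iUnion _ hcell' hdg]
  rw [finsum_sum_comm _ _ fun i _ => hfin i, finsum_sum_comm _ _ fun i _ => hfin' i]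
  refine Finset.sum_congr rfl fun i _ => ?_
  obtain ⟨E, hE⟩ := hE i
  rw [← finsum_comp_equiv E (f := flagJump (g i '' T i))]
  simp only [hE]

/-! ### Triangles are polygons -/

lemma sum_coord_eq_one (b : AffineBasis (Fin 3) ℝ Plane) {i j k : Fin 3} (hij : i ≠ j)
    (hik : i ≠ k) (hjk : j ≠ k) (x : Plane) : b.coord i x + b.coord j x + b.coord k x = 1 := by
  rw [← b.sum_coord_apply_eq_one x, Fin.sum_univ_three]
  fin_cases i <;> fin_cases j <;> fin_cases k <;> simp at hij hik hjk ⊢ <;> ring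

lemma mem_affineSegment_iff (b : AffineBasis (Fin 3) ℝ Plane) {i j k : Fin 3} (hij : i ≠ j)
    (hik : i ≠ k) (hjk : j ≠ k) (x : Plane) :
    x ∈ affineSegment ℝ (b i) (b j) ↔ 0 ≤ b.coord i x ∧ 0 ≤ b.coord j x ∧ b.coord k x = 0 := by
  have hsum := sum_coord_eq_one b hij hik hjk x
  constructor
  · rintro ⟨t, ⟨h0, h1⟩, rfl⟩
    simp only [AffineMap.apply_lineMap, b.coord_apply]
    simp [AffineMap.lineMap_apply_module, hij, hij.symm, hik.symm, hjk.symm, h0, h1]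
  · rintro ⟨hi, hj, hk⟩
    refine ⟨b.coord j x, ⟨hj, by linarith⟩, ?_⟩
    refine b.ext_elem fun l => ?_
    simp only [AffineMap.apply_lineMap, b.coord_apply]
    have hl : l = i ∨ l = j ∨ l = k := by
      fin_cases i <;> fin_cases j <;> fin_cases k <;> fin_cases l <;> simp at hij hik hjk ⊢
    rcases hl with rfl | rfl | rfl
    · simp [AffineMap.lineMap_apply_module, hij]
      linarith
    · simp [AffineMap.lineMap_apply_module, hij.symm]
    · simp [hik.symm, hjk.symm, hk]

lemma eq_vertex_of_coord_eq_zero (b : AffineBasis (Fin 3) ℝ Plane) {i j k : Fin 3} (hij : i ≠ j)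
    (hik : i ≠ k) (hjk : j ≠ k) {x : Plane} (hj : b.coord j x = 0) (hk : b.coord k x = 0) :
    x = b i := by
  have hsum := sum_coord_eq_one b hij hik hjk x
  have hx : x ∈ affineSegment ℝ (b i) (b j) :=
    (mem_affineSegment_iff b hij hik hjk x).2 ⟨by linarith, hj.ge, hk⟩
  obtain ⟨t, -, rfl⟩ := hx
  simp only [AffineMap.apply_lineMap, b.coord_apply] at hj
  simp [AffineMap.lineMap_apply_module, hij.symm] at hj
  simp [hj]

lemma isRationalPolygon_triangle {v : Fin 3 → Plane} (hv : AffineIndependent ℝ v)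
    (hr : ∀ i, IsRationalPoint (v i)) : IsRationalPolygon (triangle v) := by
  have htop : affineSpan ℝ (Set.range v) = ⊤ := by
    rw [hv.affineSpan_eq_top_iff_card_eq_finrank_add_one]
    simp
  obtain ⟨b, rfl⟩ : ∃ b : AffineBasis (Fin 3) ℝ Plane, v = b := ⟨⟨v, hv, htop⟩, rfl⟩
  have hclosed : IsClosed (triangle b) := (Set.finite_range b).isClosed_convexHull ℝ
  have hT : triangle b = {x | ∀ i, 0 ≤ b.coord i x} := b.convexHull_eq_nonneg_coord
  have hI : interior (triangle b) = {x | ∀ i, 0 < b.coord i x} := b.interior_convexHull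
  have hne : (interior (triangle b)).Nonempty := ⟨_, b.centroid_mem_interior_convexHull⟩
  have hconv : Convex ℝ (triangle b) := convex_convexHull ℝ _
  have hedge : ∀ (i : Fin 3) (x : Plane), x ∈ (Polygon.mk b).edgeSet ℝ i ↔
      0 ≤ b.coord i x ∧ 0 ≤ b.coord (i + 1) x ∧ b.coord (i + 2) x = 0 := by
    intro i x
    rw [← mem_affineSegment_iff b (by fin_cases i <;> decide) (by fin_cases i <;> decide)
      (by fin_cases i <;> decide), Polygon.edgeSet, finRotate_apply]
  refine ⟨(Set.finite_range b).isCompact_convexHull ℝ, ?_, 3, inferInstance, ⟨b⟩,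
    ⟨le_rfl, hv.injective, ?_⟩, hr, ?_⟩
  · rw [hconv.closure_interior_eq_closure_of_nonempty_interior hne, hclosed.closure_eq]
  · rintro i j hij x ⟨hi, hj⟩
    rw [hedge] at hi hj
    -- two barycentric coordinates vanish on both edges, which leaves only their common vertex
    have hcase : j = i + 1 ∨ i = j + 1 := by
      fin_cases i <;> fin_cases j <;> simp at hij ⊢
    have hadd : ∀ l : Fin 3, l ≠ l + 1 ∧ l ≠ l + 2 ∧ l + 1 ≠ l + 2 ∧ l + 1 + 2 = l := by decide
    rcases hcase with rfl | rfl
    · obtain ⟨h1, h2, h3, h4⟩ := hadd i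
      have hx := eq_vertex_of_coord_eq_zero b h1.symm h3 h2 (h4 ▸ hj.2.2) hi.2.2
      simp [hx]
    · obtain ⟨h1, h2, h3, h4⟩ := hadd j
      have hx := eq_vertex_of_coord_eq_zero b h1.symm h3 h2 (h4 ▸ hi.2.2) hj.2.2
      simp [hx]
  · rw [frontier, hclosed.closure_eq, hI, hT]
    ext x
    simp only [Polygon.boundary, Set.mem_iUnion, hedge, Set.mem_sdiff, Set.mem_ofPred_eq]
    constructor
    · rintro ⟨h0, h1⟩
      push Not at h1
      obtain ⟨k, hk⟩ := h1
      exact ⟨k + 1, h0 _, h0 _, by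
        rw [show k + 1 + 2 = k by fin_cases k <;> rfl]
        exact le_antisymm hk (h0 k)⟩
    · rintro ⟨i, h0, h1, h2⟩
      refine ⟨fun l => ?_, fun h => (h (i + 2)).ne' h2⟩
      have hl : l = i ∨ l = i + 1 ∨ l = i + 2 := by
        fin_cases i <;> fin_cases l <;> simp
      rcases hl with rfl | rfl | rfl
      exacts [h0, h1, h2.ge]

/-! ### The two triangles -/

/-- The triangle with vertices `((c+1)/5, 0)`, `(c/5, 1/5)`, `((c+1)/5, 1/5)`. The two triangles of
the theorem are the members `c = 0` and `c = 1` of this family. -/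
def shiftedVertices (c : ℤ) : Fin 3 → Plane :=
  ![![((c : ℝ) + 1) / 5, 0], ![(c : ℝ) / 5, 1 / 5], ![((c : ℝ) + 1) / 5, 1 / 5]]

lemma v12_eq : v12 = shiftedVertices 0 := by
  simp [v12, shiftedVertices]

lemma v14_eq : v14 = shiftedVertices 1 := by
  simp [v14, shiftedVertices]
  norm_num

lemma affineIndependent_shiftedVertices (c : ℤ) : AffineIndependent ℝ (shiftedVertices c) := by
  rw [affineIndependent_iff_of_fintype]
  intro w hw h
  rw [Finset.weightedVSub_eq_linear_combination _ hw] at h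
  have h0 := congrFun h 0
  have h1 := congrFun h 1
  simp [Fin.sum_univ_three, shiftedVertices] at hw h0 h1
  have e0 : w 0 = 0 := by linarith
  have e1 : w 1 = 0 := by
    have : ((c : ℝ) + 1) * (w 0 + w 1 + w 2) = 0 := by rw [hw, mul_zero]
    linarith
  have e2 : w 2 = 0 := by linarith
  intro i
  fin_cases i <;> assumption

lemma isRationalPoint_shiftedVertices (c : ℤ) (i : Fin 3) :
    IsRationalPoint (shiftedVertices c i) := by
  fin_cases i
  · exact ⟨![((c : ℚ) + 1) / 5, 0], fun j => by fin_cases j <;> simp [shiftedVertices]⟩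
  · exact ⟨![(c : ℚ) / 5, 1 / 5], fun j => by fin_cases j <;> simp [shiftedVertices]⟩
  · exact ⟨![((c : ℚ) + 1) / 5, 1 / 5], fun j => by fin_cases j <;> simp [shiftedVertices]⟩

lemma triangle_shiftedVertices (c : ℤ) : triangle (shiftedVertices c) =
    {x : Plane | 5 * x 0 ≤ c + 1 ∧ 5 * x 1 ≤ 1 ∧ (c : ℝ) + 1 ≤ 5 * (x 0 + x 1)} := by
  apply Set.Subset.antisymm
  · refine convexHull_min ?_ ?_
    · rintro _ ⟨i, rfl⟩
      fin_cases i <;> simp [shiftedVertices] <;> refine ⟨?_, ?_⟩ <;> linarith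
    · rintro x ⟨hx1, hx2, hx3⟩ y ⟨hy1, hy2, hy3⟩ s t hs ht hst
      simp only [Set.mem_ofPred_eq, Pi.add_apply, Pi.smul_apply, smul_eq_mul]
      have : t = 1 - s := by linarith
      subst this
      refine ⟨?_, ?_, ?_⟩ <;> nlinarith
  · rintro x ⟨h1, h2, h3⟩
    have h := (convex_convexHull ℝ (Set.range (shiftedVertices c))).sum_mem
      (t := Finset.univ) (w := ![1 - 5 * x 1, c + 1 - 5 * x 0, 5 * (x 0 + x 1) - (c + 1)])
      (z := shiftedVertices c) ?_ ?_ fun i _ => subset_convexHull ℝ _ ⟨i, rfl⟩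
    · have hx : x = ∑ i, (![1 - 5 * x 1, c + 1 - 5 * x 0, 5 * (x 0 + x 1) - (c + 1)] :
          Fin 3 → ℝ) i • shiftedVertices c i := by
        ext j
        fin_cases j <;> simp [Fin.sum_univ_three, shiftedVertices] <;> ring
      rw [hx]
      exact h
    · intro i _
      fin_cases i <;> simp <;> linarith
    · simp [Fin.sum_univ_three]
      ring

lemma latticePoint_mem_triangle (c : ℤ) (m : ℤ × ℤ) :
    latticePoint m ∈ triangle (shiftedVertices c) ↔
      m.1 ≤ c + 1 ∧ m.2 ≤ 1 ∧ c + 1 ≤ m.1 + m.2 := by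
  rw [triangle_shiftedVertices]
  simp only [latticePoint, Set.mem_ofPred_eq, Matrix.cons_val_zero, Matrix.cons_val_one]
  rw [← add_div, mul_div_cancel₀ _ (by norm_num : (5 : ℝ) ≠ 0),
    mul_div_cancel₀ _ (by norm_num : (5 : ℝ) ≠ 0), mul_div_cancel₀ _ (by norm_num : (5 : ℝ) ≠ 0)]
  norm_cast

lemma isMinimalTriangle_shiftedVertices (c : ℤ) : IsMinimalTriangle 5 (shiftedVertices c) := by
  refine ⟨by norm_num, affineIndependent_shiftedVertices c, Set.Subset.antisymm ?_ ?_⟩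
  · rintro x ⟨hx, m, hm⟩
    have hxm : x = latticePoint (m 0, m 1) := by
      ext i
      fin_cases i <;> simp [latticePoint, hm]
    rw [hxm, latticePoint_mem_triangle] at hx
    dsimp only at hx
    have hcase : (m 0 = c + 1 ∧ m 1 = 0) ∨ (m 0 = c ∧ m 1 = 1) ∨ (m 0 = c + 1 ∧ m 1 = 1) := by
      omega
    rcases hcase with ⟨h0, h1⟩ | ⟨h0, h1⟩ | ⟨h0, h1⟩
    · exact ⟨0, by rw [hxm, h0, h1]; simp [latticePoint, shiftedVertices]⟩
    · exact ⟨1, by rw [hxm, h0, h1]; simp [latticePoint, shiftedVertices]⟩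
    · exact ⟨2, by rw [hxm, h0, h1]; simp [latticePoint, shiftedVertices]⟩
  · rintro _ ⟨i, rfl⟩
    refine ⟨subset_convexHull ℝ _ ⟨i, rfl⟩, ?_⟩
    fin_cases i
    · exact ⟨![c + 1, 0], fun j => by fin_cases j <;> simp [shiftedVertices]⟩
    · exact ⟨![c, 1], fun j => by fin_cases j <;> simp [shiftedVertices]⟩
    · exact ⟨![c + 1, 1], fun j => by fin_cases j <;> simp [shiftedVertices]⟩

lemma triangleWeight_v12 : triangleWeight 5 v12 = {1, 1, -1} := by
  have hc : ¬ IsCounterclockwise (v12 0) (v12 1) (v12 2) := by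
    simp [IsCounterclockwise, v12]
  rw [triangleWeight, if_neg hc]
  simp [edgeWeight, numer, v12, Matrix.det_fin_two]
  decide

lemma triangleWeight_v14 : triangleWeight 5 v14 = {2, -2, 1} := by
  have hc : ¬ IsCounterclockwise (v14 0) (v14 1) (v14 2) := by
    simp [IsCounterclockwise, v14]
    norm_num
  have hfloor : ⌊(5 : ℝ) * (2 / 5)⌋ = 2 := by norm_num
  rw [triangleWeight, if_neg hc]
  simp [edgeWeight, numer, v14, Matrix.det_fin_two, hfloor]
  decide

/-! ### Ehrhart functions -/

/-- A lattice triangle with two sides parallel to the axes and `k` points on each side. -/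
lemma ncard_lattice_triangle (A B : ℤ) (k : ℕ) :
    {p : ℤ × ℤ | p.1 ≤ A ∧ p.2 ≤ B ∧ A + B < p.1 + p.2 + k}.ncard =
      ∑ s ∈ Finset.range k, (s + 1) := by
  have h : {p : ℤ × ℤ | p.1 ≤ A ∧ p.2 ≤ B ∧ A + B < p.1 + p.2 + k} =
      (fun q : (_ : ℕ) × ℕ => (A - q.2, B - (q.1 - q.2 : ℤ))) ''
        ((Finset.range k).sigma fun s => Finset.range (s + 1) : Finset ((_ : ℕ) × ℕ)) := by
    ext ⟨a, b⟩
    simp only [Set.mem_ofPred_eq, Set.mem_image, Finset.mem_coe, Finset.mem_sigma,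
      Finset.mem_range, Prod.mk.injEq, Sigma.exists]
    constructor
    · rintro ⟨h1, h2, h3⟩
      exact ⟨(A - a + (B - b)).toNat, (A - a).toNat, ⟨by omega, by omega⟩, by omega, by omega⟩
    · rintro ⟨s, i, ⟨hs, hi⟩, h1, h2⟩
      omega
  rw [h, Set.InjOn.ncard_image, Set.ncard_coe_finset, Finset.card_sigma]
  · simp
  · rintro ⟨s, i⟩ - ⟨s', i'⟩ - heq
    simp only [Prod.mk.injEq] at heq
    obtain ⟨h1, h2⟩ := heq
    have hi : i = i' := by omega
    have hs : s = s' := by omega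
    rw [hi, hs]

lemma ehr_triangle_eq_ncard (c : ℤ) (t : ℕ) : ehr (triangle (shiftedVertices c)) t =
    {p : ℤ × ℤ | 5 * p.1 ≤ (c + 1) * t ∧ 5 * p.2 ≤ t ∧ (c + 1) * t ≤ 5 * (p.1 + p.2)}.ncard := by
  have hinj : Function.Injective intVec := fun p q h => by
    have h0 := congrFun h 0
    have h1 := congrFun h 1
    simp only [intVec, Matrix.cons_val_zero, Matrix.cons_val_one, Int.cast_inj] at h0 h1
    exact Prod.ext h0 h1
  rw [ehr, ← Set.ncard_image_of_injective _ hinj]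
  congr 1
  ext y
  constructor
  · rintro ⟨⟨x, hx, rfl⟩, m, hm⟩
    rw [triangle_shiftedVertices] at hx
    obtain ⟨h1, h2, h3⟩ := hx
    have ht : (0 : ℝ) ≤ t := t.cast_nonneg
    have e0 : (t : ℝ) * x 0 = m 0 := by simpa using hm 0
    have e1 : (t : ℝ) * x 1 = m 1 := by simpa using hm 1
    refine ⟨(m 0, m 1), ⟨?_, ?_, ?_⟩, ?_⟩
    · have : (5 * m 0 : ℝ) ≤ (c + 1) * t := by rw [← e0]; nlinarith
      exact_mod_cast this
    · have : (5 * m 1 : ℝ) ≤ t := by rw [← e1]; nlinarith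
      exact_mod_cast this
    · have : ((c + 1) * t : ℝ) ≤ 5 * (m 0 + m 1) := by rw [← e0, ← e1]; nlinarith
      exact_mod_cast this
    · ext i
      fin_cases i <;> simp [intVec, e0, e1]
  · rintro ⟨p, ⟨h1, h2, h3⟩, rfl⟩
    refine ⟨?_, ![p.1, p.2], fun i => by fin_cases i <;> simp [intVec]⟩
    rcases Nat.eq_zero_or_pos t with rfl | ht
    · have hp : p = 0 := by
        simp only [Nat.cast_zero, mul_zero] at h1 h2 h3
        exact Prod.ext (by rw [Prod.fst_zero]; omega) (by rw [Prod.snd_zero]; omega)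
      refine ⟨shiftedVertices c 0, subset_convexHull ℝ _ ⟨0, rfl⟩, ?_⟩
      rw [hp]
      ext i
      fin_cases i <;> simp [intVec]
    · have htr : (0 : ℝ) < t := by exact_mod_cast ht
      refine ⟨(t : ℝ)⁻¹ • intVec p, ?_, smul_inv_smul₀ htr.ne' _⟩
      rw [triangle_shiftedVertices]
      have r1 : (5 * p.1 : ℝ) ≤ (c + 1) * t := by exact_mod_cast h1
      have r2 : (5 * p.2 : ℝ) ≤ t := by exact_mod_cast h2
      have r3 : ((c + 1) * t : ℝ) ≤ 5 * (p.1 + p.2) := by exact_mod_cast h3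
      simp only [Set.mem_ofPred_eq, Pi.smul_apply, smul_eq_mul, intVec, Matrix.cons_val_zero,
        Matrix.cons_val_one]
      refine ⟨?_, ?_, ?_⟩
      · rw [mul_left_comm, inv_mul_le_iff₀ htr]; linarith
      · rw [mul_left_comm, inv_mul_le_iff₀ htr]; linarith
      · rw [← mul_add, mul_left_comm, le_inv_mul_iff₀ htr]; linarith

lemma ehr_triangle {c : ℤ} (hc : c = 0 ∨ c = 1) (t : ℕ) :
    ehr (triangle (shiftedVertices c)) t =
      ∑ s ∈ Finset.range (if t % 5 = 0 then t / 5 + 1 else t / 5), (s + 1) := by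
  obtain ⟨q, r, hr, rfl⟩ : ∃ q r, r < 5 ∧ t = 5 * q + r := ⟨t / 5, t % 5, by omega, by omega⟩
  rw [ehr_triangle_eq_ncard, ← ncard_lattice_triangle ((c + 1) * (5 * q + r : ℕ) / 5)
    ((5 * q + r : ℕ) / 5)]
  congr 1
  ext ⟨a, b⟩
  simp only [Set.mem_ofPred_eq]
  rcases hc with rfl | rfl <;> interval_cases r <;> split_ifs with h <;> omega

lemma isQuasiPolynomialWith_ehr {c : ℤ} (hc : c = 0 ∨ c = 1) :
    IsQuasiPolynomialWith 5 sharedConstituents (ehr (triangle (shiftedVertices c))) := by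
  have hdeg : ∀ i, (sharedConstituents i).natDegree = 2 := by
    intro i
    fin_cases i <;> simp only [sharedConstituents] <;> simp <;> compute_degree!
  refine ⟨by norm_num, fun i j => by rw [hdeg, hdeg], fun j t hj => ?_⟩
  have hsum : ∀ k : ℕ, ((∑ s ∈ Finset.range k, (s + 1) : ℕ) : ℚ) = k * (k + 1) / 2 := by
    intro k
    induction k with
    | zero => simp
    | succ k ih =>
      rw [Finset.sum_range_succ, Nat.cast_add, ih]
      push_cast
      ring
  have ht : (t : ℚ) = 5 * (t / 5 : ℕ) + (t % 5 : ℕ) := by exact_mod_cast (Nat.div_add_mod t 5).symm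
  rw [ehr_triangle hc, hsum, ht, hj]
  fin_cases j <;> simp [sharedConstituents] <;> ring

/-! ### The flag invariants of the two triangles -/

lemma germMem_triangle_iff (c : ℤ) (x u w : Plane) :
    GermMem (triangle (shiftedVertices c)) x u w ↔
      0 ≤ lexSign (c + 1 - 5 * x 0) (-5 * u 0) (-5 * w 0) ∧
      0 ≤ lexSign (1 - 5 * x 1) (-5 * u 1) (-5 * w 1) ∧
      0 ≤ lexSign (5 * (x 0 + x 1) - (c + 1)) (5 * (u 0 + u 1)) (5 * (w 0 + w 1)) := by
  rw [triangle_shiftedVertices]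
  unfold GermMem
  have h1 := eventually_sign_quadratic (c + 1 - 5 * x 0) (-5 * u 0) (-5 * w 0)
  have h2 := eventually_sign_quadratic (1 - 5 * x 1) (-5 * u 1) (-5 * w 1)
  have h3 := eventually_sign_quadratic (5 * (x 0 + x 1) - (c + 1)) (5 * (u 0 + u 1))
    (5 * (w 0 + w 1))
  refine Iff.trans ?_ (eventually_const (f := 𝓝[>] (0 : ℝ)))
  refine eventually_congr ?_
  filter_upwards [h1, h2, h3] with ε h1 h2 h3
  rw [← h1, ← h2, ← h3, sign_nonneg_iff, sign_nonneg_iff, sign_nonneg_iff]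
  simp only [Pi.add_apply, Pi.smul_apply, smul_eq_mul]
  refine and_congr ?_ (and_congr ?_ ?_) <;> constructor <;> intro h <;> linarith

/-- Nonnegativity of a germ `a + bε + cε²`, as a lexicographic condition on the coefficients. -/
lemma lexSign_intCast_nonneg_iff (a b c : ℤ) :
    0 ≤ lexSign a b c ↔ 0 < a ∨ a = 0 ∧ (0 < b ∨ b = 0 ∧ 0 ≤ c) := by
  unfold lexSign
  split_ifs with ha hb <;> rw [sign_nonneg_iff] <;> norm_cast at * <;> omega

lemma germMem_triangle_int_iff (c : ℤ) (m u w : ℤ × ℤ) :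
    GermMem (triangle (shiftedVertices c)) (latticePoint m) (intVec u) (intVec w) ↔
      (m.1 < c + 1 ∨ m.1 = c + 1 ∧ (u.1 < 0 ∨ u.1 = 0 ∧ w.1 ≤ 0)) ∧
      (m.2 < 1 ∨ m.2 = 1 ∧ (u.2 < 0 ∨ u.2 = 0 ∧ w.2 ≤ 0)) ∧
      (c + 1 < m.1 + m.2 ∨ c + 1 = m.1 + m.2 ∧
        (0 < u.1 + u.2 ∨ u.1 + u.2 = 0 ∧ 0 ≤ w.1 + w.2)) := by
  have h1 := lexSign_intCast_nonneg_iff (c + 1 - m.1) (-5 * u.1) (-5 * w.1)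
  have h2 := lexSign_intCast_nonneg_iff (1 - m.2) (-5 * u.2) (-5 * w.2)
  have h3 := lexSign_intCast_nonneg_iff (m.1 + m.2 - (c + 1)) (5 * (u.1 + u.2)) (5 * (w.1 + w.2))
  have e1 : ∀ a : ℝ, 5 * (a / 5) = a := fun a => by ring
  rw [germMem_triangle_iff]
  simp only [latticePoint, intVec, Matrix.cons_val_zero, Matrix.cons_val_one, mul_add, e1]
  push_cast [mul_add] at h1 h2 h3
  rw [h1, h2, h3]
  omega

/-- The rays that start at a vertex of a triangle of the family and run along one of its edges. -/
def edgeFlags (c : ℤ) : Finset ((ℤ × ℤ) × (ℤ × ℤ)) :=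
  {((c + 1, 0), (-1, 1)), ((c + 1, 0), (0, 1)), ((c, 1), (1, -1)), ((c, 1), (1, 0)),
    ((c + 1, 1), (-1, 0)), ((c + 1, 1), (0, -1))}

/-- The triangles of the family contain no points of `L_5` but their vertices, so that the flags
along the boundary start there. -/
lemma jump_triangle (c : ℤ) {f : (ℤ × ℤ) × (ℤ × ℤ)} (hf : IsCoprime f.2.1 f.2.2) :
    jump (triangle (shiftedVertices c)) f = if f ∈ edgeFlags c then 1 else 0 := by
  obtain ⟨⟨m, n⟩, ⟨u, w⟩⟩ := f
  have hz : (0 : Plane) = intVec (0, 0) := by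
    ext i
    fin_cases i <;> simp [intVec]
  have hunit : ∀ {a b : ℤ}, IsCoprime a b → a = 0 → b = 1 ∨ b = -1 := by
    rintro a b h rfl
    exact Int.isUnit_iff.1 (isCoprime_zero_left.1 h)
  have hu := hunit hf
  have hw := hunit hf.symm
  have huw := hunit (show IsCoprime (w + u) u by simpa using hf.symm.add_mul_left_left 1)
  simp only [jump, germInd]
  rw [hz]
  simp only [germMem_triangle_int_iff, edgeFlags, Finset.mem_insert, Finset.mem_singleton,
    Prod.mk.injEq]
  dsimp only at hu hw huw
  have hcase : (m = c + 1 ∧ n = 0) ∨ (m = c ∧ n = 1) ∨ (m = c + 1 ∧ n = 1) ∨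
      (c + 1 < m ∨ 1 < n ∨ m + n < c + 1) := by omega
  rcases hcase with ⟨rfl, rfl⟩ | ⟨rfl, rfl⟩ | ⟨rfl, rfl⟩ | hout
  · simp
    split_ifs <;> omega
  · simp
    split_ifs <;> omega
  · simp
    split_ifs <;> omega
  · rw [if_neg (by omega), if_neg (by omega), if_neg (by omega), if_neg (by omega)]
    rfl

lemma flagInvariant_triangle (c : ℤ) : flagInvariant (triangle (shiftedVertices c)) =
    ∑ f ∈ edgeFlags c, if (5 : ℤ) ∣ (f.1.1 * f.2.2 - f.1.2 * f.2.1) ^ 2 - 1 then 1 else 0 := by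
  have hval : ∀ f, flagJump (triangle (shiftedVertices c)) f = if f ∈ edgeFlags c then
      (if (5 : ℤ) ∣ (f.1.1 * f.2.2 - f.1.2 * f.2.1) ^ 2 - 1 then 1 else 0) else 0 := by
    intro f
    unfold flagJump
    by_cases hcop : IsCoprime f.2.1 f.2.2
    · simp only [IsUnitFlag, hcop, true_and, jump_triangle c hcop]
      split_ifs <;> rfl
    · have hnot : f ∉ edgeFlags c := by
        intro hmem
        simp only [edgeFlags, Finset.mem_insert, Finset.mem_singleton] at hmem
        rcases hmem with rfl | rfl | rfl | rfl | rfl | rfl <;>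
          exact hcop (by
            simp [isCoprime_one_left, isCoprime_one_right, isCoprime_zero_left,
              isCoprime_zero_right])
      rw [if_neg fun h => hcop h.1, if_neg hnot]
  unfold flagInvariant
  rw [finsum_eq_sum_of_support_subset (s := edgeFlags c)]
  · exact Finset.sum_congr rfl fun f hf => by rw [hval, if_pos hf]
  · intro f hf
    by_contra hnot
    exact hf ((hval f).trans (if_neg hnot))

lemma flagInvariant_v12 : flagInvariant (triangle v12) = 6 := by
  rw [v12_eq, flagInvariant_triangle]
  decide

lemma flagInvariant_v14 : flagInvariant (triangle v14) = 2 := by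
  rw [v14_eq, flagInvariant_triangle]
  decide

lemma not_rationallyEquidecomposable :
    ¬ RationallyEquidecomposable (triangle v12) (triangle v14) := by
  intro h
  have := h.flagInvariant_eq
  rw [flagInvariant_v12, flagInvariant_v14] at this
  norm_num at this

end DiscreteEqui

end

theorem mainTheorem2 :
    -- Ehrhart equivalence does not imply rational finite discrete equidecomposability
    (¬ ∀ P Q : Set DiscreteEqui.Plane,
        DiscreteEqui.IsRationalPolygon P → DiscreteEqui.IsRationalPolygon Q →
        DiscreteEqui.EhrhartEquivalent P Q → DiscreteEqui.RationallyEquidecomposable P Q) ∧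
    -- the two triangles are rational polygons, and 5-minimal triangles
    DiscreteEqui.IsRationalPolygon (DiscreteEqui.triangle DiscreteEqui.v12) ∧
    DiscreteEqui.IsRationalPolygon (DiscreteEqui.triangle DiscreteEqui.v14) ∧
    DiscreteEqui.IsMinimalTriangle 5 DiscreteEqui.v12 ∧
    DiscreteEqui.IsMinimalTriangle 5 DiscreteEqui.v14 ∧
    -- they have the same Ehrhart quasi-polynomial
    DiscreteEqui.EhrhartEquivalent (DiscreteEqui.triangle DiscreteEqui.v12)
      (DiscreteEqui.triangle DiscreteEqui.v14) ∧
    DiscreteEqui.IsQuasiPolynomialWith 5 DiscreteEqui.sharedConstituents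
      (DiscreteEqui.ehr (DiscreteEqui.triangle DiscreteEqui.v12)) ∧
    DiscreteEqui.IsQuasiPolynomialWith 5 DiscreteEqui.sharedConstituents
      (DiscreteEqui.ehr (DiscreteEqui.triangle DiscreteEqui.v14)) ∧
    -- their weights
    DiscreteEqui.triangleWeight 5 DiscreteEqui.v12 = {1, 1, -1} ∧
    DiscreteEqui.triangleWeight 5 DiscreteEqui.v14 = {2, -2, 1} ∧
    DiscreteEqui.triangleWeight 5 DiscreteEqui.v12 ≠
      DiscreteEqui.triangleWeight 5 DiscreteEqui.v14 ∧
    -- they are not equidecomposable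
    ¬ DiscreteEqui.RationallyEquidecomposable (DiscreteEqui.triangle DiscreteEqui.v12)
      (DiscreteEqui.triangle DiscreteEqui.v14) := by
  have h12 := DiscreteEqui.v12_eq
  have h14 := DiscreteEqui.v14_eq
  have hp12 : DiscreteEqui.IsRationalPolygon (DiscreteEqui.triangle DiscreteEqui.v12) := by
    rw [h12]
    exact DiscreteEqui.isRationalPolygon_triangle (DiscreteEqui.affineIndependent_shiftedVertices 0)
      (DiscreteEqui.isRationalPoint_shiftedVertices 0)
  have hp14 : DiscreteEqui.IsRationalPolygon (DiscreteEqui.triangle DiscreteEqui.v14) := by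
    rw [h14]
    exact DiscreteEqui.isRationalPolygon_triangle (DiscreteEqui.affineIndependent_shiftedVertices 1)
      (DiscreteEqui.isRationalPoint_shiftedVertices 1)
  have hE : DiscreteEqui.EhrhartEquivalent (DiscreteEqui.triangle DiscreteEqui.v12)
      (DiscreteEqui.triangle DiscreteEqui.v14) := by
    intro t
    rw [h12, h14, DiscreteEqui.ehr_triangle (Or.inl rfl), DiscreteEqui.ehr_triangle (Or.inr rfl)]
  have hne := DiscreteEqui.not_rationallyEquidecomposable
  refine ⟨fun h => hne (h _ _ hp12 hp14 hE), hp12, hp14, ?_, ?_, hE, ?_, ?_,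
    DiscreteEqui.triangleWeight_v12, DiscreteEqui.triangleWeight_v14, ?_, hne⟩
  · exact h12 ▸ DiscreteEqui.isMinimalTriangle_shiftedVertices 0
  · exact h14 ▸ DiscreteEqui.isMinimalTriangle_shiftedVertices 1
  · exact h12 ▸ DiscreteEqui.isQuasiPolynomialWith_ehr (Or.inl rfl)
  · exact h14 ▸ DiscreteEqui.isQuasiPolynomialWith_ehr (Or.inr rfl)
  · rw [DiscreteEqui.triangleWeight_v12, DiscreteEqui.triangleWeight_v14]
    decide
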